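/- Let $X\subset\mathbb R^n$ (states) and $\Omega\subset\mathbb R^m$ (controls) be compact, let $T\ge 0$, $\varepsilon>0$, $\delta>0$, and let $f$ be a vector field of class $C^1$ on $X\times\Omega$ (i.e. on an open neighbourhood of $X\times\Omega$) with values in $\mathbb R^n$. Let $q_1,\dots,q_K:\mathbb R^n\times\mathbb R^m\to\mathbb R^n$ be polynomial maps such that $f$ satisfies the side-information constraints $\langle q_k(x,\omega),f(x,\omega)\rangle\ge 0$ for all $(x,\omega)\in X\times\Omega$ and $k=1,\dots,K$. An admissible control is a function $w:[0,T]\to\Omega$ that is continuous except at finitely many points. For a vector field $g$, a trajectory of $g$ in $X$ on $[0,t]$ with control $w$ and initial point $x_0$ is a continuous $x:[0,t]\to X$ with $x(s)=x_0+\int_0^s g(x(r),w(r))\,dr$ for $s\in[0,t]$; its velocity at time $s$ is $\dot x(s):=g(x(s),w(s))$. Let $$d(f,g)=\sup\ \max\{\|x_f(t)-x_g(t)\|_2,\ \|\dot x_f(t)-\dot x_g(t)\|_2\},$$ the supremum being over all $t\in[0,T]$, $x_0\in X$, admissible controls $w$, and trajectories $x_f$ of $f$ and $x_g$ of $g$ in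 $X$ on $[0,t]$ with control $w$ and initial point $x_0$ (so both trajectories are required to stay in $X$ up to time $t$). For real polynomials $g_1,\dots,g_a,h_1,\dots,h_b$ in $(x,\omega)$, the quadratic module $QM(g;h)$ is the set of all $\sigma_0+\sum_j\sigma_jg_j+\sum_l r_lh_l$ with $\sigma_0,\sigma_j$ sums of squares of polynomials and $r_l$ arbitrary polynomials. It is Archimedean if it contains $N-\|(x,\omega)\|_2^2$ for some $N\in\mathbb R$. The pair $(g;h)$ is a description of $X\times\Omega$ if $X\times\Omega=\{g_j\ge0\ \forall j,\ h_l=0\ \forall l\}$. Then there is a polynomial map $p:\mathbb R^n\times\mathbb R^m\to\mathbb R^n$ such that 1. $d(f,p)\le\varepsilon$; 2. $p$ $\delta$-satisfies every constraint: $\max\{0,\max_{X\times\Omega}-\langle q_k,p\rangle\}\le\delta$ for $k=1,\dots,K$ (the inner maximum being disregarded if $X\times\Omega=\emptyset$); 3. for every description $(g;h)$ of $X\times\Omega$ with Archimedean quadratic module, $\langle q_k,p\rangle+\delta\in QM(g;h)$ for $k=1,\dots,K$. Moreover, if $(g;h)$ is any description of $X\times\Omega$ and $R$ is any number with $\|(x,\omega)\|_2^2\le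 R$ on $X\times\Omega$, then adding $R-\|(x,\omega)\|_2^2$ to $g$ gives a description of $X\times\Omega$ whose quadratic module is Archimedean, and hence contains $\langle q_k,p\rangle+\delta$ for $k=1,\dots,K$. -/

import Mathlib

open Set MeasureTheory
open scoped ENNReal

noncomputable section

/-- The Euclidean space of dimension `d` (with the 2-norm). -/
abbrev Euc (d : ℕ) : Type := EuclideanSpace ℝ (Fin d)

/-- Real polynomials in the state variables `x_1, …, x_n` and the control variables
`ω_1, …, ω_m`. -/
abbrev StatePoly (n m : ℕ) : Type := MvPolynomial (Fin n ⊕ Fin m) ℝ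

/-- The value `P(x, ω)` of a polynomial at the point `z = (x, ω)`. -/
def StatePoly.evalAt {n m : ℕ} (P : StatePoly n m) (z : Euc n × Euc m) : ℝ :=
  MvPolynomial.eval (Sum.elim (fun i => z.1 i) (fun j => z.2 j)) P

/-- Polynomial maps `(p_1, …, p_n)` from `ℝⁿ × ℝᵐ` to `ℝⁿ`. -/
abbrev PolyField (n m : ℕ) : Type := Fin n → StatePoly n m

/-- The function from `ℝⁿ × ℝᵐ` to `ℝⁿ` defined by a polynomial map. -/
def PolyField.toFun {n m : ℕ} (p : PolyField n m) (z : Euc n × Euc m) : Euc n :=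
  WithLp.toLp 2 (fun i => StatePoly.evalAt (p i) z)

/-- The polynomial `⟨q(x, ω), p(x, ω)⟩`. -/
def PolyField.innerPoly {n m : ℕ} (q p : PolyField n m) : StatePoly n m :=
  ∑ i, q i * p i

/-- `f` is continuously differentiable on the (compact) set `S`: it is of class `C¹` on some open
neighbourhood of `S`. -/
def IsC1On {n m : ℕ} (f : Euc n × Euc m → Euc n) (S : Set (Euc n × Euc m)) : Prop :=
  ∃ U : Set (Euc n × Euc m), IsOpen U ∧ S ⊆ U ∧ ContDiffOn ℝ 1 f U

/-- The admissible control sequences: functions from `[0, T]` to `Ω` that are continuous except at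
finitely many points (values outside `[0, T]` are irrelevant). -/
def admissibleControls {m : ℕ} (T : ℝ) (Ω : Set (Euc m)) : Set (ℝ → Euc m) :=
  {w | (∀ s ∈ Icc 0 T, w s ∈ Ω) ∧
    {s | s ∈ Icc 0 T ∧ ¬ ContinuousWithinAt w (Icc 0 T) s}.Finite}

/-- `x` is, on `[0, t]`, a trajectory of `x' = f (x, w)` with control `w` that starts at `x₀` and
stays in `X`. Since `w` may jump, the differential equation is read in integrated form. -/
structure IsTrajectoryIn {n m : ℕ} (X : Set (Euc n)) (f : Euc n × Euc m → Euc n)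
    (w : ℝ → Euc m) (x₀ : Euc n) (t : ℝ) (x : ℝ → Euc n) : Prop where
  continuousOn : ContinuousOn x (Icc 0 t)
  mem : ∀ s ∈ Icc 0 t, x s ∈ X
  integrable : IntervalIntegrable (fun r => f (x r, w r)) volume 0 t
  eq : ∀ s ∈ Icc 0 t, x s = x₀ + ∫ r in (0 : ℝ)..s, f (x r, w r)

/-- The distance between two vector fields: the supremum, over all times `t ∈ [0, T]`, initial
points `x₀ ∈ X` and admissible controls `w` for which both trajectories stay in `X` up to time `t`,
of the larger of the distance of the positions and the distance of the velocities at time `t`.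
The velocity of a trajectory `x` of `f` at time `t` is the right-hand side `f (x t, w t)` of the
differential equation (also at `t = 0` and at the discontinuities of `w`). -/
def fieldDist {n m : ℕ} (T : ℝ) (X : Set (Euc n)) (Ω : Set (Euc m))
    (f g : Euc n × Euc m → Euc n) : ℝ≥0∞ :=
  ⨆ (t : ℝ) (_ : t ∈ Icc 0 T) (x₀ : Euc n) (_ : x₀ ∈ X)
    (w : ℝ → Euc m) (_ : w ∈ admissibleControls T Ω)
    (x : ℝ → Euc n) (_ : IsTrajectoryIn X f w x₀ t x)
    (y : ℝ → Euc n) (_ : IsTrajectoryIn X g w x₀ t y),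
    max (‖x t - y t‖ₑ) (‖f (x t, w t) - g (y t, w t)‖ₑ)

/-- `f` satisfies the side-information constraint given by the polynomial map `q`. -/
def SatisfiesSide {n m : ℕ} (X : Set (Euc n)) (Ω : Set (Euc m)) (q : PolyField n m)
    (f : Euc n × Euc m → Euc n) : Prop :=
  ∀ z ∈ X ×ˢ Ω, 0 ≤ inner ℝ (q.toFun z) (f z)

/-- The violation `max {0, max_{X × Ω} -⟨q, f⟩}` of the side-information constraint given by `q`. -/
def sideViolation {n m : ℕ} (X : Set (Euc n)) (Ω : Set (Euc m)) (q : PolyField n m)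
    (f : Euc n × Euc m → Euc n) : EReal :=
  max 0 (⨆ z ∈ X ×ˢ Ω, ((-(inner ℝ (q.toFun z) (f z)) : ℝ) : EReal))

/-- The polynomials `g_j`, `h_l` describe `S`, i.e. `S = {z | g_j(z) ≥ 0, h_l(z) = 0}`. -/
def Describes {n m a b : ℕ} (g : Fin a → StatePoly n m) (h : Fin b → StatePoly n m)
    (S : Set (Euc n × Euc m)) : Prop :=
  S = {z | (∀ j, 0 ≤ (g j).evalAt z) ∧ ∀ l, (h l).evalAt z = 0}

/-- The quadratic module of a description: all `σ₀ + ∑ σ_j g_j + ∑ r_l h_l` with sums of squares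
`σ₀`, `σ_j` and arbitrary polynomials `r_l`. -/
def quadraticModule {n m a b : ℕ} (g : Fin a → StatePoly n m) (h : Fin b → StatePoly n m) :
    Set (StatePoly n m) :=
  {P | ∃ (σ₀ : StatePoly n m) (σ : Fin a → StatePoly n m) (r : Fin b → StatePoly n m),
    IsSumSq σ₀ ∧ (∀ j, IsSumSq (σ j)) ∧ P = σ₀ + ∑ j, σ j * g j + ∑ l, r l * h l}

/-- The polynomial `R - ‖(x, ω)‖²`. -/
def ballPoly (n m : ℕ) (R : ℝ) : StatePoly n m :=
  MvPolynomial.C R - ∑ i, MvPolynomial.X i ^ 2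

/-- A set of polynomials (a quadratic module) is Archimedean: it contains `N - ‖(x, ω)‖²` for
some `N`. -/
def IsArchimedeanModule {n m : ℕ} (M : Set (StatePoly n m)) : Prop :=
  ∃ N : ℝ, ballPoly n m N ∈ M

end

/-! Approximate `f` uniformly on the compact set `X ×ˢ Ω` by a polynomial field `p`
(Stone–Weierstrass). Since `f` is Lipschitz there, Grönwall bounds positions and velocities by the
uniform error times a constant depending only on `L` and `T` (`fieldDist_le`). By Cauchy–Schwarz a
small error gives `⟨q_k, p⟩ ≥ -δ/2`, so `⟨q_k, p⟩ + δ` is strictly positive on `X ×ˢ Ω`. This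
depends on the set only, so one `p` serves every Archimedean description, by Putinar's
Positivstellensatz.

Putinar (`mem_of_eval_pos`) is proved algebraically. A maximal Archimedean quadratic module without
`-1` has residue ring `ℝ` modulo its support, hence gives a point where the module is nonnegative.
If `f` is positive at all such points, adjoining `-f` must produce `-1`, so `s * f - 1 ∈ M` for a
sum of squares `s`; a descent on constants then removes the multiplier `s`. -/

/-- A quadratic module in a commutative ring: it contains `1` and is closed under addition and
under multiplication by squares. -/
structure IsQuadraticModule {A : Type*} [CommRing A] (M : Set A) : Prop where
  one_mem : 1 ∈ M
  add_mem : ∀ {p q : A}, p ∈ M → q ∈ M → p + q ∈ M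
  sq_mul_mem : ∀ (a : A) {p : A}, p ∈ M → a ^ 2 * p ∈ M

namespace IsQuadraticModule

/-! ### Quadratic modules and maximality -/

section Ring

variable {A : Type*} [CommRing A] {M : Set A}

lemma zero_mem (hM : IsQuadraticModule M) : 0 ∈ M := by
  simpa using hM.sq_mul_mem 0 hM.one_mem

lemma sumSq_mul_mem (hM : IsQuadraticModule M) {s p : A} (hs : IsSumSq s) (hp : p ∈ M) :
    s * p ∈ M := by
  induction hs with
  | zero => simpa using hM.zero_mem
  | sq_add a _ ih =>
    rw [add_mul, ← sq]
    exact hM.add_mem (hM.sq_mul_mem a hp) ih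

lemma sumSq_mem (hM : IsQuadraticModule M) {s : A} (hs : IsSumSq s) : s ∈ M := by
  simpa using hM.sumSq_mul_mem hs hM.one_mem

lemma sq_mem (hM : IsQuadraticModule M) (a : A) : a ^ 2 ∈ M := by
  simpa using hM.sq_mul_mem a hM.one_mem

/-- The quadratic module generated by `M` and `f`. -/
def adjoin (M : Set A) (f : A) : Set A :=
  {p | ∃ m ∈ M, ∃ s : A, IsSumSq s ∧ p = m + s * f}

lemma isQuadraticModule_adjoin (hM : IsQuadraticModule M) (f : A) :
    IsQuadraticModule (adjoin M f) where
  one_mem := ⟨1, hM.one_mem, 0, .zero, by ring⟩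
  add_mem := by
    rintro _ _ ⟨m, hm, s, hs, rfl⟩ ⟨m', hm', s', hs', rfl⟩
    exact ⟨m + m', hM.add_mem hm hm', s + s', hs.add hs', by ring⟩
  sq_mul_mem := by
    rintro a _ ⟨m, hm, s, hs, rfl⟩
    exact ⟨a ^ 2 * m, hM.sq_mul_mem a hm, a * a * s, (IsSumSq.mul_self a).mul hs, by ring⟩

lemma subset_adjoin (M : Set A) (f : A) : M ⊆ adjoin M f :=
  fun m hm => ⟨m, hm, 0, .zero, by ring⟩

lemma mem_adjoin (hM : IsQuadraticModule M) (f : A) : f ∈ adjoin M f :=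
  ⟨0, hM.zero_mem, 1, .one, by ring⟩

/-- A quadratic module that does not contain `-1` lies in a maximal one. -/
lemma exists_maximal (hM : IsQuadraticModule M) (h : -1 ∉ M) :
    ∃ M', M ⊆ M' ∧ Maximal (fun N : Set A => IsQuadraticModule N ∧ -1 ∉ N) M' := by
  refine zorn_subset_nonempty {N : Set A | IsQuadraticModule N ∧ -1 ∉ N} ?_ M ⟨hM, h⟩
  intro c hc hchain hne
  refine ⟨⋃₀ c, ⟨⟨?_, ?_, ?_⟩, ?_⟩, fun s hs => subset_sUnion_of_mem hs⟩
  · obtain ⟨N, hN⟩ := hne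
    exact ⟨N, hN, (hc hN).1.one_mem⟩
  · rintro p q ⟨N, hN, hp⟩ ⟨N', hN', hq⟩
    rcases hchain.total hN hN' with hle | hle
    · exact ⟨N', hN', (hc hN').1.add_mem (hle hp) hq⟩
    · exact ⟨N, hN, (hc hN).1.add_mem hp (hle hq)⟩
  · rintro a p ⟨N, hN, hp⟩
    exact ⟨N, hN, (hc hN).1.sq_mul_mem a hp⟩
  · rintro ⟨N, hN, hp⟩
    exact (hc hN).2 hp

/-- Adjoining `f` enlarges `M` strictly, so the result must contain `-1`. -/
lemma exists_neg_one_eq_of_maximal (hM : Maximal (fun N : Set A => IsQuadraticModule N ∧ -1 ∉ N) M)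
    {f : A} (hf : f ∉ M) : ∃ m ∈ M, ∃ s : A, IsSumSq s ∧ -1 = m + s * f := by
  by_contra h
  exact hf (hM.2 ⟨hM.1.1.isQuadraticModule_adjoin f, h⟩ (subset_adjoin M f)
    (hM.1.1.mem_adjoin f))

end Ring

/-! ### Maximal Archimedean quadratic modules over the reals -/

section Algebra

variable {A : Type*} [CommRing A] [Algebra ℝ A] {M : Set A}

lemma isSumSq_algebraMap {r : ℝ} (hr : 0 ≤ r) : IsSumSq (algebraMap ℝ A r) := by
  rw [← Real.mul_self_sqrt hr, map_mul]
  exact IsSumSq.mul_self _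

lemma algebraMap_mem (hM : IsQuadraticModule M) {r : ℝ} (hr : 0 ≤ r) : algebraMap ℝ A r ∈ M :=
  hM.sumSq_mem (isSumSq_algebraMap hr)

lemma algebraMap_mul_mem (hM : IsQuadraticModule M) {r : ℝ} (hr : 0 ≤ r) {p : A} (hp : p ∈ M) :
    algebraMap ℝ A r * p ∈ M :=
  hM.sumSq_mul_mem (isSumSq_algebraMap hr) hp

lemma nonneg_of_algebraMap_mem (hM : IsQuadraticModule M) (h : -1 ∉ M) {r : ℝ}
    (hr : algebraMap ℝ A r ∈ M) : 0 ≤ r := by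
  by_contra! hneg
  apply h
  have := hM.algebraMap_mul_mem (inv_nonneg.2 (neg_nonneg.2 hneg.le)) hr
  rwa [← map_mul, inv_neg, neg_mul, inv_mul_cancel₀ hneg.ne, map_neg, map_one] at this

/-- The support `M ∩ -M` of a quadratic module. -/
def support (hM : IsQuadraticModule M) : Ideal A where
  carrier := {p | p ∈ M ∧ -p ∈ M}
  zero_mem' := ⟨hM.zero_mem, by simpa using hM.zero_mem⟩
  add_mem' := by
    rintro p q ⟨hp, hp'⟩ ⟨hq, hq'⟩
    exact ⟨hM.add_mem hp hq, by rw [neg_add]; exact hM.add_mem hp' hq'⟩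
  smul_mem' := by
    rintro a p ⟨hp, hp'⟩
    have half : algebraMap ℝ A (1 / 2) * 2 = 1 := by
      rw [← map_ofNat (algebraMap ℝ A) 2, ← map_mul]
      norm_num
    -- Every `a` is a difference of squares, `((a + 1) / 2)² - ((a - 1) / 2)²`.
    have key : ∀ p : A, a * p = (algebraMap ℝ A (1 / 2) * (a + 1)) ^ 2 * p +
        (algebraMap ℝ A (1 / 2) * (a - 1)) ^ 2 * (-p) := fun p => by
      linear_combination -(a * p * (algebraMap ℝ A (1 / 2) * 2 + 1)) * half
    refine ⟨?_, ?_⟩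
    · rw [smul_eq_mul, key]
      exact hM.add_mem (hM.sq_mul_mem _ hp) (hM.sq_mul_mem _ hp')
    · rw [smul_eq_mul, ← mul_neg, key]
      exact hM.add_mem (hM.sq_mul_mem _ hp') (hM.sq_mul_mem _ (by rwa [neg_neg]))

lemma mem_or_neg_mem_of_maximal
    (hM : Maximal (fun N : Set A => IsQuadraticModule N ∧ -1 ∉ N) M) (f : A) :
    f ∈ M ∨ -f ∈ M := by
  by_contra! h
  obtain ⟨m₁, hm₁, s₁, hs₁, e₁⟩ := exists_neg_one_eq_of_maximal hM h.1
  obtain ⟨m₂, hm₂, s₂, hs₂, e₂⟩ := exists_neg_one_eq_of_maximal hM h.2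
  have hQ := hM.1.1
  have hs : s₁ ∈ hQ.support := by
    refine ⟨hQ.sumSq_mem hs₁, ?_⟩
    -- Cross-multiplying by `s₂` and `s₁` cancels the terms in `f`.
    have : -s₁ = s₂ + (s₂ * m₁ + s₁ * m₂) := by linear_combination s₂ * e₁ + s₁ * e₂
    rw [this]
    exact hQ.add_mem (hQ.sumSq_mem hs₂)
      (hQ.add_mem (hQ.sumSq_mul_mem hs₂ hm₁) (hQ.sumSq_mul_mem hs₁ hm₂))
  apply hM.1.2
  rw [e₁, mul_comm]
  exact hQ.add_mem hm₁ (hQ.support.mul_mem_left f hs).1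

/-- An Archimedean maximal quadratic module is closed. -/
lemma mem_of_forall_add_mem_of_maximal
    (hM : Maximal (fun N : Set A => IsQuadraticModule N ∧ -1 ∉ N) M)
    (hA : ∀ p : A, ∃ N : ℝ, algebraMap ℝ A N - p ∈ M) {u : A}
    (hu : ∀ e : ℝ, 0 < e → algebraMap ℝ A e + u ∈ M) : u ∈ M := by
  by_contra h
  obtain ⟨m, hm, s, hs, e⟩ := exists_neg_one_eq_of_maximal hM h
  obtain ⟨N, hN⟩ := hA s
  have hQ := hM.1.1
  -- Adding `m + s * (b + u)` and `b * (N - s)` leaves `b * N - 1`; this `b` makes it negative.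
  set b : ℝ := (|N| + 1)⁻¹ / 2 with hb
  have hb0 : 0 < b := by positivity
  have hmem : algebraMap ℝ A (b * N - 1) ∈ M := by
    have h2 := hQ.add_mem (hQ.add_mem hm (hQ.sumSq_mul_mem hs (hu b hb0)))
      (hQ.algebraMap_mul_mem hb0.le hN)
    convert h2 using 1
    rw [map_sub, map_mul, map_one]
    linear_combination e
  have h3 := hQ.nonneg_of_algebraMap_mem hM.1.2 hmem
  have h4 : b * N ≤ 1 / 2 := by
    calc b * N ≤ b * (|N| + 1) := by gcongr; linarith [le_abs_self N]
      _ = 1 / 2 := by rw [hb]; field_simp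
  linarith

/-- Modulo the support of an Archimedean maximal quadratic module every element is a real
number. -/
lemma exists_sub_algebraMap_mem_support
    (hM : Maximal (fun N : Set A => IsQuadraticModule N ∧ -1 ∉ N) M)
    (hA : ∀ p : A, ∃ N : ℝ, algebraMap ℝ A N - p ∈ M) (p : A) :
    ∃ a : ℝ, p - algebraMap ℝ A a ∈ hM.1.1.support := by
  have hQ := hM.1.1
  -- The value of `p` is found as a Dedekind cut: its supremum.
  set S : Set ℝ := {r | p - algebraMap ℝ A r ∈ M}
  have hne : S.Nonempty := by
    obtain ⟨N, hN⟩ := hA (-p)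
    refine ⟨-N, ?_⟩
    change p - algebraMap ℝ A (-N) ∈ M
    rw [map_neg]
    convert hN using 1
    ring
  have hbdd : BddAbove S := by
    obtain ⟨N, hN⟩ := hA p
    refine ⟨N, fun r hr => ?_⟩
    have : algebraMap ℝ A (N - r) ∈ M := by
      convert hQ.add_mem hN hr using 1
      rw [map_sub]
      ring
    linarith [hQ.nonneg_of_algebraMap_mem hM.1.2 this]
  refine ⟨sSup S, ?_, ?_⟩
  · refine mem_of_forall_add_mem_of_maximal hM hA fun e he => ?_
    obtain ⟨r, hr, hlt⟩ := exists_lt_of_lt_csSup hne (sub_lt_self (sSup S) he)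
    convert hQ.add_mem hr (hQ.algebraMap_mem (r := r - (sSup S - e)) (by linarith)) using 1
    rw [map_sub, map_sub]
    ring
  · refine mem_of_forall_add_mem_of_maximal hM hA fun e he => ?_
    have hnot : p - algebraMap ℝ A (sSup S + e) ∉ M := fun hmem => by
      have := le_csSup hbdd (show sSup S + e ∈ S from hmem)
      linarith
    convert (mem_or_neg_mem_of_maximal hM _).resolve_left hnot using 1
    rw [map_add]
    ring

end Algebra

/-! ### Putinar's Positivstellensatz -/

section MvPolynomial

open MvPolynomial

variable {ι : Type*} {M : Set (MvPolynomial ι ℝ)}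

/-- An Archimedean quadratic module without `-1` has a common point of nonnegativity. -/
lemma exists_forall_eval_nonneg (hM : IsQuadraticModule M)
    (hA : ∀ p, ∃ N : ℝ, C N - p ∈ M) (h : -1 ∉ M) :
    ∃ z : ι → ℝ, ∀ p ∈ M, 0 ≤ eval z p := by
  obtain ⟨M', hle, hM'⟩ := hM.exists_maximal h
  have hA' : ∀ p, ∃ N : ℝ, algebraMap ℝ (MvPolynomial ι ℝ) N - p ∈ M' := fun p =>
    (hA p).imp fun N hN => hle hN
  choose z hz using fun i => exists_sub_algebraMap_mem_support hM' hA' (X i)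
  have key : ∀ p : MvPolynomial ι ℝ, p - C (eval z p) ∈ hM'.1.1.support := by
    intro p
    induction p using MvPolynomial.induction_on with
    | C a => simp
    | add p q hp hq =>
      convert Ideal.add_mem _ hp hq using 1
      rw [map_add, map_add]
      ring
    | mul_X p i hp =>
      convert Ideal.add_mem _ (Ideal.mul_mem_left _ (X i) hp)
        (Ideal.mul_mem_left _ (C (eval z p)) (hz i)) using 1
      rw [map_mul, map_mul, eval_X, algebraMap_eq]
      ring
  refine ⟨z, fun p hp => hM'.1.1.nonneg_of_algebraMap_mem hM'.1.2 ?_⟩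
  convert hM'.1.1.add_mem (hle hp) (key p).2 using 1
  rw [algebraMap_eq]
  ring

/-- If a quadratic module contains `N - ‖x‖²`, then every polynomial is bounded by a real number
with respect to it. -/
lemma exists_C_sub_mem [Fintype ι] (hM : IsQuadraticModule M) {N : ℝ}
    (hN : C N - ∑ i, X i ^ 2 ∈ M) (p : MvPolynomial ι ℝ) : ∃ N : ℝ, C N - p ∈ M := by
  have hmul : ∀ {r : ℝ}, 0 ≤ r → ∀ {p : MvPolynomial ι ℝ}, p ∈ M → C r * p ∈ M :=
    fun hr _ hp => hM.algebraMap_mul_mem hr hp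
  have hX : ∀ i, C |N| - X i ^ 2 ∈ M := fun i => by
    classical
    have h1 : ∑ j ∈ Finset.univ.erase i, (X j : MvPolynomial ι ℝ) ^ 2 ∈ M :=
      hM.sumSq_mem (IsSumSq.sum_sq _ _)
    have h2 : C (|N| - N) ∈ M := hM.algebraMap_mem (sub_nonneg.2 (le_abs_self N))
    convert hM.add_mem (hM.add_mem hN h1) h2 using 1
    rw [← Finset.add_sum_erase _ _ (Finset.mem_univ i), C_sub]
    ring
  -- Bounding squares, rather than `p` itself, makes the induction pass through sums and products.
  have key : ∀ p : MvPolynomial ι ℝ, ∃ N : ℝ, 0 ≤ N ∧ C N - p ^ 2 ∈ M := by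
    intro p
    induction p using MvPolynomial.induction_on with
    | C a => exact ⟨a ^ 2, sq_nonneg a, by rw [C_pow, sub_self]; exact hM.zero_mem⟩
    | add p q hp hq =>
      obtain ⟨N₁, h₁, hp⟩ := hp
      obtain ⟨N₂, h₂, hq⟩ := hq
      refine ⟨2 * N₁ + 2 * N₂, by positivity, ?_⟩
      convert hM.add_mem (hM.add_mem (hmul zero_le_two hp) (hmul zero_le_two hq))
        (hM.sq_mem (p - q)) using 1
      rw [C_add, C_mul, C_mul, map_ofNat]
      ring
    | mul_X p i hp =>
      obtain ⟨N₁, h₁, hp⟩ := hp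
      refine ⟨N₁ * |N|, by positivity, ?_⟩
      convert hM.add_mem (hmul h₁ (hX i)) (hM.sq_mul_mem (X i) hp) using 1
      rw [C_mul]
      ring
  obtain ⟨N', -, hp⟩ := key p
  refine ⟨N' + (1 / 2) ^ 2, ?_⟩
  convert hM.add_mem hp (hM.sq_mem (p - C (1 / 2))) using 1
  have : (2 : MvPolynomial ι ℝ) * C (1 / 2) = 1 := by
    rw [← map_ofNat C 2, ← C_mul]
    norm_num
  rw [C_add, C_pow]
  linear_combination p * this

/-- **Putinar's Positivstellensatz**: a polynomial that is positive at the points where an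
Archimedean quadratic module is nonnegative belongs to the quadratic module. -/
theorem mem_of_eval_pos (hM : IsQuadraticModule M) (hA : ∀ p, ∃ N : ℝ, C N - p ∈ M)
    {f : MvPolynomial ι ℝ} (hf : ∀ z : ι → ℝ, (∀ p ∈ M, 0 ≤ eval z p) → 0 < eval z f) :
    f ∈ M := by
  have hmul : ∀ {r : ℝ}, 0 ≤ r → ∀ {p : MvPolynomial ι ℝ}, p ∈ M → C r * p ∈ M :=
    fun hr _ hp => hM.algebraMap_mul_mem hr hp
  have hC : ∀ {r : ℝ}, 0 ≤ r → C r ∈ M := fun hr => hM.algebraMap_mem hr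
  obtain ⟨s, hs, hsf⟩ : ∃ s, IsSumSq s ∧ s * f - 1 ∈ M := by
    have h1 : (-1 : MvPolynomial ι ℝ) ∈ adjoin M (-f) := by
      by_contra h
      obtain ⟨z, hz⟩ := (hM.isQuadraticModule_adjoin (-f)).exists_forall_eval_nonneg
        (fun p => (hA p).imp fun N hN => subset_adjoin M _ hN) h
      have h2 := hf z fun p hp => hz p (subset_adjoin M _ hp)
      have h3 := hz _ (hM.mem_adjoin (-f))
      rw [map_neg] at h3
      linarith
    obtain ⟨m, hm, s, hs, e⟩ := h1
    refine ⟨s, hs, ?_⟩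
    convert hm using 1
    linear_combination e
  obtain ⟨k, hk, hk1, hk2⟩ : ∃ k : ℝ, 0 < k ∧ C (2 * k) - s ∈ M ∧
      C (2 * k) - s ^ 2 * f - 1 ∈ M := by
    obtain ⟨N₁, h₁⟩ := hA s
    obtain ⟨N₂, h₂⟩ := hA (s ^ 2 * f + 1)
    refine ⟨|N₁| + |N₂| + 1, by positivity, ?_, ?_⟩
    · convert hM.add_mem h₁ (hC (r := 2 * (|N₁| + |N₂| + 1) - N₁)
        (by linarith [le_abs_self N₁, abs_nonneg N₁, abs_nonneg N₂])) using 1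
      rw [C_sub]
      ring
    · convert hM.add_mem h₂ (hC (r := 2 * (|N₁| + |N₂| + 1) - N₂)
        (by linarith [le_abs_self N₂, abs_nonneg N₁, abs_nonneg N₂])) using 1
      rw [C_sub]
      ring
  -- With `r ≥ 0`, `k²(f + r) - 1` equals `(k - s)²(f + r) + 2k(sf - 1) + rs(2k - s) + (2k - s²f -
  -- 1)`, so the constant can drop by `1/k²`.
  have hstep : ∀ r : ℝ, 0 ≤ r → f + C r ∈ M → f + C (r - (k ^ 2)⁻¹) ∈ M := by
    intro r hr hfr
    have h1 : C (k ^ 2) * (f + C r) - 1 ∈ M := by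
      convert hM.add_mem (hM.add_mem (hM.add_mem (hM.sq_mul_mem (C k - s) hfr)
        (hmul (by positivity : 0 ≤ 2 * k) hsf)) (hmul hr (hM.sumSq_mul_mem hs hk1))) hk2 using 1
      rw [C_mul, C_pow, map_ofNat]
      ring
    have h2 := hmul (inv_nonneg.2 (sq_nonneg k)) h1
    have h3 : C (k ^ 2)⁻¹ * C (k ^ 2) = (1 : MvPolynomial ι ℝ) := by
      rw [← C_mul, inv_mul_cancel₀ (by positivity), C_1]
    convert h2 using 1
    rw [C_sub]
    linear_combination -(f + C r) * h3
  obtain ⟨N, hN⟩ := hA (-f)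
  have hiter : ∀ j : ℕ, f ∈ M ∨ f + C (N - j * (k ^ 2)⁻¹) ∈ M := by
    intro j
    induction j with
    | zero =>
      right
      convert hN using 1
      rw [Nat.cast_zero, zero_mul, sub_zero]
      ring
    | succ j ih =>
      rcases ih with ih | ih
      · exact .inl ih
      rcases le_or_gt 0 (N - j * (k ^ 2)⁻¹) with h0 | h0
      · right
        convert hstep _ h0 ih using 3
        push_cast
        ring
      · left
        convert hM.add_mem ih (hC (neg_nonneg.2 h0.le)) using 1
        rw [C_neg]
        ring
  obtain ⟨j, hj⟩ := exists_nat_gt (N / (k ^ 2)⁻¹)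
  rw [div_lt_iff₀ (by positivity)] at hj
  rcases hiter j with h | h
  · exact h
  · convert hM.add_mem h (hC (r := -(N - j * (k ^ 2)⁻¹)) (by linarith)) using 1
    rw [C_neg]
    ring

end MvPolynomial

end IsQuadraticModule

/-! ### Quadratic modules of descriptions -/

section QuadraticModule

variable {n m a b : ℕ}

lemma isQuadraticModule_quadraticModule (g : Fin a → StatePoly n m) (h : Fin b → StatePoly n m) :
    IsQuadraticModule (quadraticModule g h) where
  one_mem := ⟨1, fun _ => 0, fun _ => 0, .one, fun _ => .zero, by simp⟩
  add_mem := by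
    rintro _ _ ⟨s, σ, r, hs, hσ, rfl⟩ ⟨s', σ', r', hs', hσ', rfl⟩
    refine ⟨s + s', σ + σ', r + r', hs.add hs', fun j => (hσ j).add (hσ' j), ?_⟩
    simp only [Pi.add_apply, add_mul, Finset.sum_add_distrib]
    ring
  sq_mul_mem := by
    rintro c _ ⟨s, σ, r, hs, hσ, rfl⟩
    refine ⟨c * c * s, fun j => c * c * σ j, fun l => c ^ 2 * r l, (IsSumSq.mul_self c).mul hs,
      fun j => (IsSumSq.mul_self c).mul (hσ j), ?_⟩
    simp only [mul_assoc, ← Finset.mul_sum]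
    ring

lemma ineq_mem_quadraticModule (g : Fin a → StatePoly n m) (h : Fin b → StatePoly n m)
    (j : Fin a) : g j ∈ quadraticModule g h := by
  classical
  refine ⟨0, Pi.single j 1, 0, .zero, fun i => ?_, by simp [Pi.single_apply]⟩
  rcases eq_or_ne i j with rfl | hij
  · simp
  · simp [hij]

lemma mul_eq_mem_quadraticModule (g : Fin a → StatePoly n m) (h : Fin b → StatePoly n m)
    (l : Fin b) (c : StatePoly n m) : c * h l ∈ quadraticModule g h := by
  classical
  exact ⟨0, 0, Pi.single l c, .zero, fun _ => .zero, by simp [Pi.single_apply]⟩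

/-- Putinar's Positivstellensatz for a description of a set. -/
lemma Describes.mem_quadraticModule {g : Fin a → StatePoly n m} {h : Fin b → StatePoly n m}
    {S : Set (Euc n × Euc m)} (hS : Describes g h S)
    (hA : IsArchimedeanModule (quadraticModule g h)) {P : StatePoly n m}
    (hP : ∀ z ∈ S, 0 < P.evalAt z) : P ∈ quadraticModule g h := by
  have hM := isQuadraticModule_quadraticModule g h
  obtain ⟨N, hN⟩ := hA
  refine hM.mem_of_eval_pos (hM.exists_C_sub_mem hN) fun z hz => ?_
  set y : Euc n × Euc m := (WithLp.toLp 2 (z ∘ Sum.inl), WithLp.toLp 2 (z ∘ Sum.inr))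
  have hev : ∀ Q : StatePoly n m, Q.evalAt y = MvPolynomial.eval z Q := fun Q => by
    rw [StatePoly.evalAt]
    congr 2
    exact Sum.elim_comp_inl_inr z
  rw [← hev]
  refine hP y ?_
  rw [hS]
  refine ⟨fun j => ?_, fun l => le_antisymm ?_ ?_⟩
  · rw [hev]
    exact hz _ (ineq_mem_quadraticModule g h j)
  -- Both `h l` and `-h l` lie in the module, which forces equality.
  · have := hz _ (mul_eq_mem_quadraticModule g h l (-1))
    rw [neg_one_mul, map_neg] at this
    rw [hev]
    linarith
  · have := hz _ (mul_eq_mem_quadraticModule g h l 1)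
    rwa [one_mul, ← hev] at this

lemma evalAt_ballPoly (R : ℝ) (z : Euc n × Euc m) :
    (ballPoly n m R).evalAt z = R - (‖z.1‖ ^ 2 + ‖z.2‖ ^ 2) := by
  simp [ballPoly, StatePoly.evalAt, EuclideanSpace.real_norm_sq_eq]

lemma Describes.cons_ballPoly {g : Fin a → StatePoly n m} {h : Fin b → StatePoly n m}
    {S : Set (Euc n × Euc m)} (hS : Describes g h S) {R : ℝ}
    (hR : ∀ z ∈ S, ‖z.1‖ ^ 2 + ‖z.2‖ ^ 2 ≤ R) :
    Describes (Fin.cons (ballPoly n m R) g : Fin (a + 1) → StatePoly n m) h S := by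
  have hmem : ∀ z, z ∈ S ↔ (∀ j, 0 ≤ (g j).evalAt z) ∧ ∀ l, (h l).evalAt z = 0 := fun z => by
    conv_lhs => rw [hS]
    rfl
  ext z
  change z ∈ S ↔ (∀ j : Fin (a + 1), _) ∧ _
  rw [Fin.forall_fin_succ]
  simp only [Fin.cons_zero, Fin.cons_succ, evalAt_ballPoly, sub_nonneg, and_assoc, ← hmem]
  exact ⟨fun hz => ⟨hR z hz, hz⟩, fun hz => hz.2⟩

end QuadraticModule

/-! ### Polynomial approximation and Lipschitz bounds -/

section Approximation

variable {n m : ℕ}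

lemma continuous_evalAt (P : StatePoly n m) : Continuous fun z => P.evalAt z := by
  refine (MvPolynomial.continuous_eval P).comp (continuous_pi fun i => ?_)
  rcases i with i | j
  · exact (EuclideanSpace.proj i).continuous.comp continuous_fst
  · exact (EuclideanSpace.proj j).continuous.comp continuous_snd

lemma continuous_polyField (p : PolyField n m) : Continuous p.toFun :=
  (PiLp.continuous_toLp 2 _).comp (continuous_pi fun i => continuous_evalAt (p i))

lemma evalAt_innerPoly (q p : PolyField n m) (z : Euc n × Euc m) :
    (q.innerPoly p).evalAt z = inner ℝ (q.toFun z) (p.toFun z) := by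
  simp [PolyField.innerPoly, StatePoly.evalAt, PolyField.toFun, PiLp.inner_apply, mul_comm]

/-- Stone–Weierstrass for polynomials in states and controls. -/
lemma exists_statePoly_near {S : Set (Euc n × Euc m)} (hS : IsCompact S)
    {f : Euc n × Euc m → ℝ} (hf : ContinuousOn f S) {e : ℝ} (he : 0 < e) :
    ∃ P : StatePoly n m, ∀ z ∈ S, |P.evalAt z - f z| < e := by
  have := isCompact_iff_compactSpace.1 hS
  let c : Fin n ⊕ Fin m → C(S, ℝ) := fun i =>
    ⟨fun z => StatePoly.evalAt (MvPolynomial.X i) z.1,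
      (continuous_evalAt _).comp continuous_subtype_val⟩
  have hc : ∀ (P : StatePoly n m) (z : S), MvPolynomial.aeval c P z = P.evalAt z.1 := by
    intro P z
    induction P using MvPolynomial.induction_on with
    | C r => simp [StatePoly.evalAt]
    | add P Q hP hQ => rw [map_add, ContinuousMap.add_apply, hP, hQ]; simp [StatePoly.evalAt]
    | mul_X P i hP =>
      rw [map_mul, ContinuousMap.mul_apply, hP, MvPolynomial.aeval_X]
      simp [StatePoly.evalAt, c]
  have hsep : (MvPolynomial.aeval c : StatePoly n m →ₐ[ℝ] C(S, ℝ)).range.SeparatesPoints := by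
    intro y z hyz
    by_contra! hcon
    have hX : ∀ i, StatePoly.evalAt (MvPolynomial.X i) y.1 =
        StatePoly.evalAt (MvPolynomial.X i) z.1 := fun i => by
      rw [← hc, ← hc]
      exact hcon _ ⟨_, ⟨MvPolynomial.X i, rfl⟩, rfl⟩
    refine hyz (Subtype.ext (Prod.ext ?_ ?_))
    · ext i
      simpa [StatePoly.evalAt] using hX (Sum.inl i)
    · ext j
      simpa [StatePoly.evalAt] using hX (Sum.inr j)
  obtain ⟨⟨_, ⟨P, rfl⟩⟩, hP⟩ :=
    ContinuousMap.exists_mem_subalgebra_near_continuousMap_of_separatesPoints _ hsep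
      ⟨S.domRestrict f, hf.domRestrict⟩ e he
  refine ⟨P, fun z hz => ?_⟩
  have := ((ContinuousMap.norm_coe_le_norm _ (⟨z, hz⟩ : S)).trans_lt hP)
  rw [← hc P ⟨z, hz⟩]
  exact this

lemma exists_polyField_near {S : Set (Euc n × Euc m)} (hS : IsCompact S)
    {f : Euc n × Euc m → Euc n} (hf : ContinuousOn f S) {e : ℝ} (he : 0 < e) :
    ∃ p : PolyField n m, ∀ z ∈ S, ‖f z - p.toFun z‖ ≤ e := by
  choose p hp using fun i : Fin n => exists_statePoly_near hS
    ((EuclideanSpace.proj (𝕜 := ℝ) i).continuous.comp_continuousOn hf)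
    (show 0 < e / (n + 1) by positivity)
  refine ⟨p, fun z hz => ?_⟩
  refine le_of_sq_le_sq ?_ he.le
  rw [EuclideanSpace.real_norm_sq_eq]
  calc ∑ i, (f z - PolyField.toFun p z) i ^ 2 ≤ ∑ _i : Fin n, (e / (n + 1)) ^ 2 := by
        refine Finset.sum_le_sum fun i _ => ?_
        rw [sq_le_sq, abs_of_pos (show 0 < e / (n + 1) by positivity), abs_le]
        have := abs_lt.1 (hp i z hz)
        have hi : (f z - PolyField.toFun p z) i = f z i - (p i).evalAt z := rfl
        rw [hi]
        exact ⟨by linarith! [this.2], by linarith! [this.1]⟩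
    _ = n * (e / (n + 1)) ^ 2 := by simp
    _ ≤ (n + 1) ^ 2 * (e / (n + 1)) ^ 2 := by
        gcongr
        nlinarith [Nat.cast_nonneg (α := ℝ) n]
    _ = e ^ 2 := by field_simp

lemma IsC1On.continuousOn {f : Euc n × Euc m → Euc n} {S : Set (Euc n × Euc m)}
    (hf : IsC1On f S) : ContinuousOn f S := by
  obtain ⟨U, -, hSU, hU⟩ := hf
  exact hU.continuousOn.mono hSU

lemma IsC1On.exists_lipschitzOnWith {f : Euc n × Euc m → Euc n} {S : Set (Euc n × Euc m)}
    (hf : IsC1On f S) (hS : IsCompact S) : ∃ L, LipschitzOnWith L f S := by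
  obtain ⟨U, hUo, hSU, hU⟩ := hf
  -- The set need not be convex; compactness replaces the mean value inequality.
  refine LocallyLipschitzOn.exists_lipschitzOnWith_of_compact hS fun z hz => ?_
  obtain ⟨L, t, ht, hL⟩ :=
    (hU.contDiffAt (hUo.mem_nhds (hSU hz))).exists_lipschitzOnWith
  exact ⟨L, t, mem_nhdsWithin_of_mem_nhds ht, hL⟩

end Approximation

/-! ### Grönwall estimates for trajectories -/

section Trajectories

/-- Grönwall's inequality in integrated form. -/
lemma le_gronwallBound_of_le_integral {u : ℝ → ℝ} {L e t : ℝ} (hL : 0 ≤ L)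
    (hu : ContinuousOn u (Icc 0 t))
    (h : ∀ s ∈ Icc 0 t, u s ≤ ∫ r in (0 : ℝ)..s, (L * u r + e)) :
    ∀ s ∈ Icc 0 t, u s ≤ gronwallBound 0 L e s := by
  intro s hs
  have ht : 0 ≤ t := hs.1.trans hs.2
  -- The continuous extension makes the integral differentiable everywhere, endpoints included.
  set U : ℝ → ℝ := IccExtend ht ((Icc 0 t).domRestrict u)
  have hUc : Continuous U := hu.domRestrict.Icc_extend'
  have hUu : ∀ r ∈ Icc 0 t, U r = u r := fun r hr => IccExtend_of_mem ht _ hr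
  have hcont : Continuous fun r => L * U r + e := by fun_prop
  have hder : ∀ r, HasDerivAt (fun s => ∫ r in (0 : ℝ)..s, (L * U r + e)) (L * U r + e) r :=
    fun r => hcont.integral_hasStrictDerivAt 0 r |>.hasDerivAt
  have hle : ∀ r ∈ Icc 0 t, u r ≤ ∫ r in (0 : ℝ)..r, (L * U r + e) := fun r hr => by
    refine (h r hr).trans_eq (intervalIntegral.integral_congr fun y hy => ?_)
    rw [uIcc_of_le hr.1] at hy
    simp only [hUu y ⟨hy.1, hy.2.trans hr.2⟩]
  refine (hle s hs).trans ?_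
  have := le_gronwallBound_of_liminf_deriv_right_le (δ := 0) (K := L) (ε := e) (a := 0) (b := t)
    (fun r _ => (hder r).continuousAt.continuousWithinAt)
    (f' := fun r => L * U r + e)
    (fun r _ _ hlt => (hder r).hasDerivWithinAt.liminf_right_slope_le hlt) (by simp)
    (fun r hr => by
      have hr' := Ico_subset_Icc_self hr
      have := hle r hr'
      rw [← hUu r hr'] at this
      gcongr) s hs
  rwa [sub_zero] at this

variable {n m : ℕ} {X : Set (Euc n)} {Ω : Set (Euc m)} {f g : Euc n × Euc m → Euc n}

/-- Passing through `f (b, ω)` needs a Lipschitz constant for `f` only, uniform in `ω`. -/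
lemma norm_sub_le_of_lipschitzOnWith {L : NNReal} {e : ℝ} (hL : LipschitzOnWith L f (X ×ˢ Ω))
    (hfg : ∀ z ∈ X ×ˢ Ω, ‖f z - g z‖ ≤ e) {a b : Euc n} {ω : Euc m} (ha : a ∈ X) (hb : b ∈ X)
    (hω : ω ∈ Ω) : ‖f (a, ω) - g (b, ω)‖ ≤ L * ‖a - b‖ + e := by
  have h1 := hL.norm_sub_le (x := (a, ω)) (y := (b, ω)) ⟨ha, hω⟩ ⟨hb, hω⟩
  have h2 : ‖((a, ω) : Euc n × Euc m) - (b, ω)‖ = ‖a - b‖ := by simp [Prod.norm_def]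
  rw [h2] at h1
  calc ‖f (a, ω) - g (b, ω)‖ ≤ ‖f (a, ω) - f (b, ω)‖ + ‖f (b, ω) - g (b, ω)‖ :=
        norm_sub_le_norm_sub_add_norm_sub ..
    _ ≤ _ := add_le_add h1 (hfg _ ⟨hb, hω⟩)

/-- Trajectories of nearby vector fields stay close. -/
lemma IsTrajectoryIn.norm_sub_le_gronwallBound {w : ℝ → Euc m} {x₀ : Euc n} {t : ℝ}
    {x y : ℝ → Euc n} (hx : IsTrajectoryIn X f w x₀ t x) (hy : IsTrajectoryIn X g w x₀ t y)
    (hw : ∀ s ∈ Icc 0 t, w s ∈ Ω) {L : NNReal} {e : ℝ} (hL : LipschitzOnWith L f (X ×ˢ Ω))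
    (hfg : ∀ z ∈ X ×ˢ Ω, ‖f z - g z‖ ≤ e) :
    ∀ s ∈ Icc 0 t, ‖x s - y s‖ ≤ gronwallBound 0 L e s := by
  have hc : ContinuousOn (fun s => ‖x s - y s‖) (Icc 0 t) :=
    (hx.continuousOn.sub hy.continuousOn).norm
  refine le_gronwallBound_of_le_integral L.2 hc fun s hs => ?_
  have hsub : Icc 0 s ⊆ Icc 0 t := Icc_subset_Icc_right hs.2
  have hsub' : uIcc 0 s ⊆ uIcc 0 t := by
    rwa [uIcc_of_le hs.1, uIcc_of_le (hs.1.trans hs.2)]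
  rw [hx.eq s hs, hy.eq s hs, add_sub_add_left_eq_sub, ← intervalIntegral.integral_sub
    (hx.integrable.mono_set hsub') (hy.integrable.mono_set hsub')]
  refine intervalIntegral.norm_integral_le_of_norm_le hs.1 (ae_of_all _ fun r hr => ?_) ?_
  · have hr' := hsub (Ioc_subset_Icc_self hr)
    exact norm_sub_le_of_lipschitzOnWith hL hfg (hx.mem r hr') (hy.mem r hr') (hw r hr')
  · refine ContinuousOn.intervalIntegrable ?_
    rw [uIcc_of_le hs.1]
    exact (continuousOn_const.mul (hc.mono hsub)).add continuousOn_const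

/-- Linearity in `e` lets the approximation error be chosen after the constant. -/
lemma gronwallBound_zero_eq_mul {L : ℝ} (e s : ℝ) :
    gronwallBound 0 L e s = e * gronwallBound 0 L 1 s := by
  rcases eq_or_ne L 0 with rfl | hL
  · simp [gronwallBound_K0]
  · simp only [gronwallBound_of_K_ne_0 hL]
    ring

/-- The distance of vector fields is controlled by their uniform distance. -/
lemma fieldDist_le {T : ℝ} {L : NNReal} {e : ℝ} (he : 0 ≤ e)
    (hL : LipschitzOnWith L f (X ×ˢ Ω)) (hfg : ∀ z ∈ X ×ˢ Ω, ‖f z - g z‖ ≤ e) :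
    fieldDist T X Ω f g ≤
      ENNReal.ofReal (e * (gronwallBound 0 L 1 T + L * gronwallBound 0 L 1 T + 1)) := by
  refine iSup₂_le fun t ht => iSup₂_le fun x₀ _ => iSup₂_le fun w hw => iSup₂_le fun x hx =>
    iSup₂_le fun y hy => ?_
  have htt : t ∈ Icc 0 t := ⟨ht.1, le_rfl⟩
  have hmono := gronwallBound_mono (le_refl 0) (zero_le_one (α := ℝ)) L.2
  have hG : 0 ≤ gronwallBound 0 L 1 T := by
    simpa [gronwallBound_x0] using hmono (ht.1.trans ht.2)
  have h1 : ‖x t - y t‖ ≤ e * gronwallBound 0 L 1 T := by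
    refine (hx.norm_sub_le_gronwallBound hy (fun s hs => hw.1 s ⟨hs.1, hs.2.trans ht.2⟩) hL hfg t
      htt).trans ?_
    rw [gronwallBound_zero_eq_mul]
    exact mul_le_mul_of_nonneg_left (hmono ht.2) he
  have h2 : ‖f (x t, w t) - g (y t, w t)‖ ≤ L * (e * gronwallBound 0 L 1 T) + e :=
    (norm_sub_le_of_lipschitzOnWith hL hfg (hx.mem t htt) (hy.mem t htt) (hw.1 t ht)).trans
      (by gcongr)
  have h3 : 0 ≤ e * gronwallBound 0 L 1 T := mul_nonneg he hG
  have h4 : 0 ≤ L * (e * gronwallBound 0 L 1 T) := mul_nonneg L.2 h3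
  rw [← ofReal_norm, ← ofReal_norm]
  refine max_le (ENNReal.ofReal_le_ofReal ?_) (ENNReal.ofReal_le_ofReal ?_) <;> linarith

end Trajectories

/-! ### The main theorem -/

theorem theorem1 {n m K : ℕ} (T ε δ : ℝ) (hT : 0 ≤ T) (hε : 0 < ε) (hδ : 0 < δ)
    (X : Set (Euc n)) (Ω : Set (Euc m)) (hX : IsCompact X) (hΩ : IsCompact Ω)
    (q : Fin K → PolyField n m) (f : Euc n × Euc m → Euc n)
    (hf : IsC1On f (X ×ˢ Ω)) (hS : ∀ k, SatisfiesSide X Ω (q k) f) :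
    ∃ p : PolyField n m,
      fieldDist T X Ω f p.toFun ≤ ENNReal.ofReal ε ∧
      (∀ k, sideViolation X Ω (q k) p.toFun ≤ (δ : EReal)) ∧
      (∀ (a b : ℕ) (g : Fin a → StatePoly n m) (h : Fin b → StatePoly n m),
        Describes g h (X ×ˢ Ω) →
          (IsArchimedeanModule (quadraticModule g h) →
            ∀ k, (q k).innerPoly p + MvPolynomial.C δ ∈ quadraticModule g h) ∧
          (∀ R : ℝ, (∀ z ∈ X ×ˢ Ω, ‖z.1‖ ^ 2 + ‖z.2‖ ^ 2 ≤ R) →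
            Describes (Fin.cons (ballPoly n m R) g : Fin (a + 1) → StatePoly n m) h (X ×ˢ Ω) ∧
            IsArchimedeanModule
              (quadraticModule (Fin.cons (ballPoly n m R) g : Fin (a + 1) → StatePoly n m) h) ∧
            ∀ k, (q k).innerPoly p + MvPolynomial.C δ ∈
              quadraticModule (Fin.cons (ballPoly n m R) g : Fin (a + 1) → StatePoly n m) h)) := by
  have hc : IsCompact (X ×ˢ Ω) := hX.prod hΩ
  obtain ⟨L, hL⟩ := hf.exists_lipschitzOnWith hc
  obtain ⟨B, hB⟩ := hc.exists_bound_of_continuousOn (f := fun z => ∑ k, ‖(q k).toFun z‖)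
    (continuous_finsetSum _ fun k _ => (continuous_polyField (q k)).norm).continuousOn
  have hG : 0 ≤ gronwallBound 0 L 1 T := by
    simpa [gronwallBound_x0] using gronwallBound_mono (le_refl 0) (zero_le_one (α := ℝ)) L.2 hT
  set D : ℝ := gronwallBound 0 L 1 T + L * gronwallBound 0 L 1 T + 1
  have hD : 0 < D := by
    have := mul_nonneg L.2 hG
    positivity
  -- The first bound gives distance at most `ε`; the second limits the change in each `⟨q_k, f⟩` to
  -- `δ/2`, leaving slack for strict positivity.
  set e : ℝ := min (ε / D) (δ / (2 * (|B| + 1)))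
  have he : 0 < e := lt_min (by positivity) (by positivity)
  obtain ⟨p, hp⟩ := exists_polyField_near hc hf.continuousOn he
  have hq : ∀ k, ∀ z ∈ X ×ˢ Ω, -(δ / 2) ≤ inner ℝ ((q k).toFun z) (p.toFun z) := by
    intro k z hz
    have h1 : ‖(q k).toFun z‖ ≤ |B| + 1 := by
      have := hB z hz
      rw [Real.norm_of_nonneg (Finset.sum_nonneg fun _ _ => norm_nonneg _)] at this
      linarith [le_abs_self B, Finset.single_le_sum (f := fun k => ‖(q k).toFun z‖)
        (fun _ _ => norm_nonneg _) (Finset.mem_univ k)]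
    have h2 : inner ℝ ((q k).toFun z) (f z - p.toFun z) ≤ δ / 2 :=
      calc inner ℝ ((q k).toFun z) (f z - p.toFun z)
          ≤ ‖(q k).toFun z‖ * ‖f z - p.toFun z‖ := real_inner_le_norm _ _
        _ ≤ (|B| + 1) * (δ / (2 * (|B| + 1))) :=
            mul_le_mul h1 ((hp z hz).trans (min_le_right _ _)) (norm_nonneg _) (by positivity)
        _ = δ / 2 := by field_simp
    rw [inner_sub_right] at h2
    linarith [hS k z hz]
  have hpos : ∀ k, ∀ z ∈ X ×ˢ Ω,
      0 < StatePoly.evalAt ((q k).innerPoly p + MvPolynomial.C δ) z := by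
    intro k z hz
    have : StatePoly.evalAt ((q k).innerPoly p + MvPolynomial.C δ) z =
        inner ℝ ((q k).toFun z) (p.toFun z) + δ := by
      rw [← evalAt_innerPoly]
      simp [StatePoly.evalAt]
    linarith [hq k z hz]
  refine ⟨p, ?_, fun k => ?_, fun a b g h hd => ⟨fun hA k => hd.mem_quadraticModule hA (hpos k),
    fun R hR => ?_⟩⟩
  · refine (fieldDist_le he.le hL hp).trans (ENNReal.ofReal_le_ofReal ?_)
    exact (le_div_iff₀ hD).1 (min_le_left _ _)
  · refine max_le (by exact_mod_cast hδ.le) (iSup₂_le fun z hz => ?_)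
    exact_mod_cast (by linarith [hq k z hz] : -(inner ℝ ((q k).toFun z) (p.toFun z)) ≤ δ)
  · have hd' := hd.cons_ballPoly hR
    have hA : IsArchimedeanModule
        (quadraticModule (Fin.cons (ballPoly n m R) g : Fin (a + 1) → StatePoly n m) h) :=
      ⟨R, ineq_mem_quadraticModule (Fin.cons (ballPoly n m R) g : Fin (a + 1) → StatePoly n m) h 0⟩
    exact ⟨hd', hA, fun k => hd'.mem_quadraticModule hA (hpos k)⟩
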